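/- A finitely generated group is \emph{one-ended} if its Cayley graph with respect to some (equivalently, any) finite generating set has exactly one end. Two groups are \emph{abstractly commensurable} if they contain isomorphic subgroups of finite index. Let $\mathcal{C}$ be a family of groups that is closed under taking finite-index subgroups. A \emph{multiplicative invariant} on $\mathcal{C}$ is a function $\rho:\mathcal{C}\to\mathbb{R}$ that takes equal values on isomorphic groups and satisfies $\rho(H)=[G:H]\,\rho(G)$ whenever $G\in\mathcal{C}$ and $H$ is a finite-index subgroup of $G$. \textbf{Theorem.} Let $\mathcal{C}$ be a family of one-ended groups that is closed under taking finite-index subgroups, and let $\rho$ be a multiplicative invariant on $\mathcal{C}$ with $\rho(G)\neq 0$ for every $G\in\mathcal{C}$. Let $m>1$, and for each $1\le i\le m$ let $G_i\in\mathcal{C}$ and let $H_i\le G_i$ be a proper subgroup of finite index. Then the free products $G_1*\cdots*G_m$ and $H_1*\cdots*H_m$ are not abstractly commensurable. -/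

import Mathlib

universe u

/-- A group is one-ended if it is finitely generated and its Cayley graph with respect to a
finite generating set has exactly one end. The number of ends does not depend on the
finite generating set. -/
def IsOneEnded (G : Type u) [Group G] : Prop :=
  ∃ S : Finset G, Subgroup.closure (S : Set G) = ⊤ ∧
    (SimpleGraph.mulCayley (S : Set G)).end.encard = 1

/-- Two groups are abstractly commensurable if they contain isomorphic subgroups of finite
index. -/
def AbstractlyCommensurable (G H : Type u) [Group G] [Group H] : Prop :=
  ∃ (G' : Subgroup G) (H' : Subgroup H),
    G'.FiniteIndex ∧ H'.FiniteIndex ∧ Nonempty (G' ≃* H')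

/-- A family of groups, given by its membership predicate, is closed under taking finite-index
subgroups. -/
def ClosedUnderFiniteIndex (C : (G : Type u) → [Group G] → Prop) : Prop :=
  ∀ (G : Type u) [Group G], C G → ∀ H : Subgroup G, H.FiniteIndex → C H

/-- `ρ` is a multiplicative invariant on the family `C`. Only the values of `ρ` on members of `C`
matter. -/
structure IsMultiplicativeInvariant (C : (G : Type u) → [Group G] → Prop)
    (ρ : (G : Type u) → [Group G] → ℝ) : Prop where
  /-- `ρ` is an invariant: isomorphic members of the family have the same value. -/
  map_mulEquiv : ∀ (G H : Type u) [Group G] [Group H], C G → C H → (G ≃* H) → ρ G = ρ H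
  /-- `ρ` is multiplicative: `ρ(H) = [G : H] ρ(G)` for `H` of finite index in `G`. -/
  map_subgroup : ∀ (G : Type u) [Group G], C G → ∀ H : Subgroup G, H.FiniteIndex →
    ρ H = (H.index : ℝ) * ρ G

/-! Let `K` be a group embedded with finite index in both free products. It acts on the cosets of
the factors of each, that is, on the vertices with nontrivial stabilizer in the two Bass–Serre
trees. Stabilizers are isomorphic to finite-index subgroups of factors, hence one-ended, and a
one-ended subgroup of a free product is conjugate into a factor
(`IsOneEnded.exists_conj_mem_range`). So each stabilizer for one action fixes a point of the other;
as a nontrivial element fixes at most one point, the two `K`-sets are isomorphic.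

The `K`-set remembers two numbers. Counting its affine functions to `ZMod 2` gives `2 ^ (1 + index *
(m - 1))`, so both embeddings have the same index. Summing `|ρ|` of stabilizers over orbits gives
the index times the sum of `|ρ|` over the factors. Hence both families of factors have the same sum
of `|ρ|`. But passing to a proper finite-index subgroup strictly increases `|ρ|`. Absolute values
are needed because `ρ` may change sign across the family. -/

open Monoid Monoid.CoprodI

namespace Monoid.CoprodI

/-! ### First letters of reduced words in a free product. -/

section Words

variable {ι : Type*} {G : ι → Type*} [∀ i, Group (G i)]

open Classical in
/-- The elements of a free product whose reduced word starts with a letter of the factor `i`. -/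
def startsIn (G : ι → Type*) [∀ i, Group (G i)] (i : ι) : Set (CoprodI G) :=
  {g | (Word.equiv g).fstIdx = some i}

open Classical in
/-- The number of letters of the reduced word of an element of a free product. -/
noncomputable def wordLength (g : CoprodI G) : ℕ := (Word.equiv g).toList.length

open Classical in
theorem mem_startsIn {i : ι} {g : CoprodI G} :
    g ∈ startsIn G i ↔ (Word.equiv g).fstIdx = some i := Iff.rfl

open Classical in
theorem prod_mem_startsIn {i : ι} {w : Word G} :
    w.prod ∈ startsIn G i ↔ w.fstIdx = some i := by
  rw [mem_startsIn]
  exact Eq.congr_left (congrArg _ (Word.equiv.apply_symm_apply w))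

open Classical in
theorem wordLength_prod (w : Word G) : wordLength w.prod = w.toList.length :=
  congrArg (fun v : Word G => v.toList.length) (Word.equiv.apply_symm_apply w)

open Classical in
theorem exists_word (g : CoprodI G) : ∃ w : Word G, w.prod = g :=
  ⟨Word.equiv g, Word.equiv.symm_apply_apply g⟩

theorem one_notMem_startsIn (i : ι) : (1 : CoprodI G) ∉ startsIn G i := by
  rw [← Word.prod_empty, prod_mem_startsIn]
  simp [Word.fstIdx, Word.empty]

theorem eq_of_mem_startsIn {i j : ι} {g : CoprodI G} (hi : g ∈ startsIn G i)
    (hj : g ∈ startsIn G j) : i = j :=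
  Option.some_injective _ (hi.symm.trans hj)

theorem exists_mem_startsIn {g : CoprodI G} (hg : g ≠ 1) : ∃ i, g ∈ startsIn G i := by
  classical
  obtain ⟨w, rfl⟩ := exists_word g
  obtain ⟨i, j, v, rfl⟩ := NeWord.of_word w (by rintro rfl; exact hg rfl)
  exact ⟨i, prod_mem_startsIn.2 (by simp [Word.fstIdx, NeWord.toWord])⟩

theorem NeWord.prod_mem_startsIn {i j : ι} (w : NeWord G i j) : w.prod ∈ startsIn G i :=
  CoprodI.prod_mem_startsIn.2 (by simp [Word.fstIdx, NeWord.toWord])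

theorem exists_neWord {i : ι} {g : CoprodI G} (hg : g ∈ startsIn G i) :
    ∃ (j : ι) (w : NeWord G i j), w.prod = g := by
  obtain ⟨w, rfl⟩ := exists_word g
  obtain ⟨k, j, v, rfl⟩ := NeWord.of_word w (by
    rintro rfl; exact one_notMem_startsIn i hg)
  obtain rfl := eq_of_mem_startsIn hg v.prod_mem_startsIn
  exact ⟨j, v, rfl⟩

theorem of_mul_mem_startsIn {i : ι} {x : G i} (hx : x ≠ 1) {g : CoprodI G}
    (hg : g ∉ startsIn G i) : of x * g ∈ startsIn G i := by
  obtain ⟨w, rfl⟩ := exists_word g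
  rw [prod_mem_startsIn] at hg
  rw [← Word.prod_cons i x w hx hg, prod_mem_startsIn, Word.fstIdx_cons]

theorem wordLength_of_mul {i : ι} {x : G i} (hx : x ≠ 1) {g : CoprodI G}
    (hg : g ∉ startsIn G i) : wordLength (of x * g) = wordLength g + 1 := by
  obtain ⟨w, rfl⟩ := exists_word g
  rw [prod_mem_startsIn] at hg
  rw [← Word.prod_cons i x w hx hg, wordLength_prod, wordLength_prod]
  simp [Word.cons]

theorem of_mem_startsIn {i : ι} {x : G i} (hx : x ≠ 1) : (of x : CoprodI G) ∈ startsIn G i := by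
  simpa using of_mul_mem_startsIn hx (one_notMem_startsIn i)

theorem of_notMem_startsIn {i j : ι} (hij : i ≠ j) (x : G i) :
    (of x : CoprodI G) ∉ startsIn G j := by
  rcases eq_or_ne x 1 with rfl | hx
  · simpa using one_notMem_startsIn j
  · exact fun h => hij (eq_of_mem_startsIn (of_mem_startsIn hx) h)

/-- Splitting off the letter of a reduced word that lies in a given factor. -/
theorem exists_eq_of_mul (i : ι) (g : CoprodI G) :
    ∃ (x : G i) (g' : CoprodI G), g' ∉ startsIn G i ∧ g = of x * g' := by
  classical
  obtain ⟨w, rfl⟩ := exists_word g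
  refine ⟨(Word.equivPair i w).head, (Word.equivPair i w).tail.prod, ?_, ?_⟩
  · rw [prod_mem_startsIn]
    exact (Word.equivPair i w).fstIdx_ne
  · rw [← Word.prod_smul, Word.equivPair_head_smul_equivPair_tail]

/-- The condition on `w⁻¹` says that the last letter of `w` is not in factor `j`, so the reduced
words concatenate without cancellation. -/
theorem mul_mem_startsIn {j k : ι} {w y : CoprodI G} (hw : w ∈ startsIn G k)
    (hw' : w⁻¹ ∉ startsIn G j) (hy : y ∈ startsIn G j) : w * y ∈ startsIn G k := by
  obtain ⟨l, w, rfl⟩ := exists_neWord hw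
  obtain ⟨l', y, rfl⟩ := exists_neWord hy
  have hlj : l ≠ j := by
    rintro rfl
    exact hw' (by rw [← NeWord.inv_prod]; exact w.inv.prod_mem_startsIn)
  rw [← NeWord.append_prod (hne := hlj)]
  exact NeWord.prod_mem_startsIn _

/-- Right multiplication by a letter changes the first letter only for words of length one. -/
theorem mul_of_mem_startsIn {i j : ι} (x : G j) {g : CoprodI G} (hg : g ∈ startsIn G i) :
    g * of x ∈ startsIn G i ∨ g ∈ (of : G j →* CoprodI G).range := by
  classical
  obtain ⟨w, rfl⟩ := exists_word g
  induction w using Word.consRecOn generalizing i with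
  | empty => exact absurd hg (one_notMem_startsIn i)
  | cons k y w h1 h2 ih =>
    rw [prod_mem_startsIn, Word.fstIdx_cons] at hg
    obtain rfl := Option.some_injective _ hg
    rw [Word.prod_cons, mul_assoc]
    have hw : w.prod ∉ startsIn G k := by rwa [prod_mem_startsIn]
    by_cases hw1 : w.prod = 1
    · rw [hw1, one_mul, mul_one]
      by_cases hkj : k = j
      · subst hkj
        exact Or.inr ⟨y, rfl⟩
      · exact Or.inl (of_mul_mem_startsIn h2 (of_notMem_startsIn (Ne.symm hkj) x))
    · left
      apply of_mul_mem_startsIn h2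
      obtain ⟨l, hl⟩ := exists_mem_startsIn hw1
      rcases ih hl with h | ⟨z, hz⟩
      · intro h'
        obtain rfl := eq_of_mem_startsIn h h'
        exact hw hl
      · rw [← hz, ← map_mul]
        apply of_notMem_startsIn
        rintro rfl
        rw [← hz] at hl hw
        obtain rfl : l = j := by
          by_contra hne
          exact of_notMem_startsIn (Ne.symm hne) z hl
        exact hw hl

/-- The set of elements starting in a given factor is almost invariant under right
multiplication. -/
theorem finite_startsIn_symmDiff (i : ι) (x : CoprodI G) :
    {g : CoprodI G | ¬ (g ∈ startsIn G i ↔ g * x ∈ startsIn G i)}.Finite := by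
  induction x using CoprodI.induction_on with
  | one => simp
  | of j x =>
    have key : ∀ (y : G j) (g : CoprodI G), g ∈ startsIn G i → g * of y ∉ startsIn G i →
        g = of y⁻¹ := by
      intro y g hg hgy
      rcases mul_of_mem_startsIn y hg with h | ⟨z, rfl⟩
      · exact absurd h hgy
      · obtain rfl : i = j := by
          by_contra hne
          exact of_notMem_startsIn (Ne.symm hne) z hg
        rw [← map_mul] at hgy
        by_contra hne
        apply hgy (of_mem_startsIn _)
        rintro h
        exact hne (by rw [eq_inv_of_mul_eq_one_left h])
    -- For a single letter `x`, membership can change only when `g = 1` or `g * of x = 1`.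
    refine (Set.toFinite {1, of x⁻¹}).subset fun g hg => ?_
    rcases Classical.em (g ∈ startsIn G i) with h | h
    · exact Or.inr (key x g h fun h' => hg (by simp [h, h']))
    · left
      have h' : g * of x ∈ startsIn G i := by
        by_contra h'
        exact hg (by simp [h, h'])
      have := key x⁻¹ (g * of x) h' (by simpa [mul_assoc] using h)
      simpa using this
  | mul x y hx hy =>
    refine (hx.union (hy.preimage (f := fun g => g * x)
      (mul_left_injective x).injOn)).subset fun g hg => ?_
    simp only [Set.mem_union, Set.mem_preimage, Set.mem_ofPred_eq, ← mul_assoc] at hg ⊢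
    tauto

/-- Distinct conjugates of factors of a free product intersect trivially. -/
theorem eq_of_of_mul_eq_mul_of {i j : ι} {h : G i} (hh : h ≠ 1) {k : G j} {x : CoprodI G}
    (e : of h * x = x * of k) : i = j ∧ x ∈ (of : G i →* CoprodI G).range := by
  -- Cancelling `a` leaves `y` not starting in `i`. The left side then starts in `i`, whereas right
  -- multiplication by `k` keeps the first letter of `y` unless `y` lies in factor `j`.
  obtain ⟨a, y, hy, rfl⟩ := exists_eq_of_mul i x
  have e' : of (a⁻¹ * h * a) * y = y * of k := by
    simp only [map_mul, map_inv, mul_assoc] at e ⊢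
    rw [e]
    group
  have hne : a⁻¹ * h * a ≠ 1 := fun h1 => hh (by simpa [mul_assoc, inv_mul_eq_one] using h1)
  have hmem : y * of k ∈ startsIn G i := e' ▸ of_mul_mem_startsIn hne hy
  by_cases hy1 : y = 1
  · subst hy1
    rw [one_mul] at hmem
    refine ⟨?_, a, by simp⟩
    by_contra hij
    exact of_notMem_startsIn (Ne.symm hij) k hmem
  · obtain ⟨l, hl⟩ := exists_mem_startsIn hy1
    rcases mul_of_mem_startsIn k hl with h' | ⟨z, rfl⟩
    · exact absurd (eq_of_mem_startsIn h' hmem ▸ hl) hy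
    · rw [← map_mul] at hmem
      obtain rfl : j = i := by
        by_contra hij
        exact of_notMem_startsIn hij _ hmem
      exact ⟨rfl, a * z, by simp⟩

end Words

end Monoid.CoprodI

/-! ### Ends and almost invariant sets. -/

section Ends

open SimpleGraph CategoryTheory

/-- In a locally finite connected graph, an infinite component of the complement of a finite set
is selected by some end. -/
theorem SimpleGraph.exists_end_of_infinite_supp {V : Type u} (Γ : SimpleGraph V)
    [LocallyFinite Γ] [Fact Γ.Preconnected] (K : Finset V) (C : Γ.ComponentCompl K)
    (hC : C.supp.Infinite) :
    ∃ e ∈ Γ.end, e (Opposite.op K) = C := by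
  have hinf : Infinite V := Set.infinite_univ_iff.1 (hC.mono (Set.subset_univ _))
  have : ∀ L, Finite (Γ.componentComplFunctor.obj L) := fun L => componentCompl_finite L.unop
  have : ∀ L, Nonempty (Γ.componentComplFunctor.obj L) :=
    fun L => componentCompl_nonempty_of_infinite Γ L.unop
  let F := Γ.componentComplFunctor
  -- The eventual range consists of the infinite components, and its transition maps are surjective,
  -- so an infinite component extends to a section.
  have hML : F.IsMittagLeffler :=
    F.isMittagLeffler_of_exists_finite_range
      fun j => ⟨j, 𝟙 j, Set.toFinite _⟩
  have hCmem : C ∈ F.eventualRange (Opposite.op K) :=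
    (Γ.infinite_iff_in_eventualRange (K := Opposite.op K) C).1 hC
  have hne : ∀ L, Nonempty (F.toEventualRanges.obj L) := F.toEventualRanges_nonempty hML
  obtain ⟨s, hs⟩ := F.toEventualRanges.eval_section_surjective_of_surjective
    (F.surjective_toEventualRanges hML) (Opposite.op K) ⟨C, hCmem⟩
  exact ⟨_, (F.toEventualRangesSectionsEquiv s).2, congrArg Subtype.val hs⟩

theorem mulCayley_preconnected {A : Type u} [Group A] {S : Finset A}
    (hS : Subgroup.closure (S : Set A) = ⊤) : (mulCayley (S : Set A)).Preconnected := by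
  have h1 : ∀ a b : A, (mulCayley (S : Set A)).Reachable a (a * b) := by
    intro a b
    have hb : b ∈ Subgroup.closure (S : Set A) := hS ▸ Subgroup.mem_top b
    induction hb using Subgroup.closure_induction generalizing a with
    | mem s hs =>
      by_cases h : a = a * s
      · rw [← h]
      · exact Adj.reachable (by rw [mulCayley_adj']; exact ⟨h, s, hs, Or.inl rfl⟩)
    | one => rw [mul_one]
    | mul x y _ _ hx hy => rw [← mul_assoc]; exact (hx a).trans (hy _)
    | inv x _ hx => simpa using (hx (a * x⁻¹)).symm
  intro a b
  simpa using h1 a (a⁻¹ * b)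

theorem mulCayley_finite_neighborSet {A : Type u} [Group A] (S : Finset A) (a : A) :
    ((mulCayley (S : Set A)).neighborSet a).Finite := by
  refine ((S.finite_toSet.image (fun s => a * s)).union
    (S.finite_toSet.image (fun s => a * s⁻¹))).subset fun b hb => ?_
  rw [mem_neighborSet, mulCayley_adj'] at hb
  obtain ⟨-, s, hs, rfl | rfl⟩ := hb
  · exact Or.inl ⟨s, hs, rfl⟩
  · exact Or.inr ⟨s, hs, by simp⟩

/-- An end chooses a nonempty component outside every finite set; in a finite group that set can be
everything. -/
theorem IsOneEnded.infinite {A : Type u} [Group A] (hA : IsOneEnded A) : Infinite A := by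
  obtain ⟨S, -, hend⟩ := hA
  by_contra hfin
  rw [not_infinite_iff_finite] at hfin
  obtain ⟨e, he⟩ := Set.encard_eq_one.1 hend
  obtain ⟨v, hv⟩ := (e (Opposite.op (Set.toFinite (Set.univ : Set A)).toFinset)).nonempty
  exact ComponentCompl.notMem_of_mem hv (by simp)

/-- In a one-ended group, every subset with finite coboundary is finite or cofinite. -/
theorem IsOneEnded.exists_finite_or_finite_compl {A : Type u} [Group A] (hA : IsOneEnded A) :
    ∃ S : Finset A, Subgroup.closure (S : Set A) = ⊤ ∧
      ∀ X : Set A, (∀ s ∈ S, {a | ¬ (a ∈ X ↔ a * s ∈ X)}.Finite) → X.Finite ∨ Xᶜ.Finite := by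
  classical
  obtain ⟨S, hS, hend⟩ := hA
  refine ⟨S, hS, fun X hX => ?_⟩
  let Γ := mulCayley (S : Set A)
  let _ : LocallyFinite Γ := fun a => (mulCayley_finite_neighborSet S a).fintype
  have _ : Fact Γ.Preconnected := ⟨mulCayley_preconnected hS⟩
  have hB : (⋃ s ∈ S, {a | ¬ (a ∈ X ↔ a * s ∈ X)}).Finite := S.finite_toSet.biUnion hX
  obtain ⟨K, hK⟩ : ∃ K : Finset A, ∀ s ∈ S, ∀ a, ¬ (a ∈ X ↔ a * s ∈ X) → a ∈ K :=
    ⟨hB.toFinset, fun s hs a ha => by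
      simp only [Set.Finite.mem_toFinset, Set.mem_iUnion]
      exact ⟨s, hs, ha⟩⟩
  have hadj : ∀ a b, a ∉ K → b ∉ K → Γ.Adj a b → (a ∈ X ↔ b ∈ X) := by
    intro a b ha hb hab
    rw [mulCayley_adj'] at hab
    obtain ⟨-, s, hs, rfl | rfl⟩ := hab
    · by_contra h
      exact ha (hK s hs _ h)
    · by_contra h
      exact hb (hK s hs _ fun h' => h h'.symm)
  -- Once `K` contains the coboundary, membership in `X` is constant on components, so `X` and its
  -- complement, if both infinite, would carry different ends.
  let side : Γ.ComponentCompl (K : Set A) → Prop :=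
    ComponentCompl.lift (fun v _ => v ∈ X) fun v w hv hw h => propext (hadj v w hv hw h)
  have hside : ∀ (C : Γ.ComponentCompl (K : Set A)) (v : A), v ∈ C → (side C ↔ v ∈ X) := by
    rintro _ v ⟨hv, rfl⟩
    exact Iff.rfl
  have hfin : Finite (Γ.ComponentCompl (K : Set A)) := componentCompl_finite K
  have key : ∀ Y : Set A, Y.Infinite →
      ∃ e ∈ Γ.end, ∃ C : Γ.ComponentCompl (K : Set A), e (Opposite.op K) = C ∧
        ∃ v ∈ Y, v ∈ C := by
    intro Y hY
    have hYK : (Y \ K).Infinite := hY.sdiff K.finite_toSet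
    obtain ⟨C, hC⟩ : ∃ C : Γ.ComponentCompl (K : Set A), (Y ∩ C.supp).Infinite := by
      by_contra! h
      refine hYK ((Set.finite_iUnion h).subset fun v hv => ?_)
      exact Set.mem_iUnion.2 ⟨Γ.componentComplMk hv.2, hv.1, hv.2, rfl⟩
    obtain ⟨e, he, heC⟩ := Γ.exists_end_of_infinite_supp K C (hC.mono Set.inter_subset_right)
    obtain ⟨v, hvY, hvC⟩ := hC.nonempty
    exact ⟨e, he, C, heC, v, hvY, hvC⟩
  by_contra! h
  obtain ⟨e, he, C, hC, v, hv, hvC⟩ := key X h.1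
  obtain ⟨e', he', C', hC', w, hw, hwC⟩ := key Xᶜ h.2
  obtain rfl : e = e' := (Set.encard_le_one_iff.1 hend.le) e e' he he'
  obtain rfl : C = C' := hC.symm.trans hC'
  exact hw ((hside C w hwC).1 ((hside C v hvC).2 hv))

end Ends

/-! ### One-ended subgroups of free products are elliptic. -/

section Elliptic

variable {ι : Type*} {G : ι → Type*} [∀ i, Group (G i)] {A : Type*} [Group A]

/-- The elements of `A` whose image under `f` lies on the far side of the edge `(g, i)` of the
Bass–Serre tree of the free product. -/
def halfSpace (f : A →* CoprodI G) (g : CoprodI G) (i : ι) : Set A :=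
  {a | g⁻¹ * f a ∈ startsIn G i}

theorem mem_halfSpace {f : A →* CoprodI G} {g : CoprodI G} {i : ι} {a : A} :
    a ∈ halfSpace f g i ↔ g⁻¹ * f a ∈ startsIn G i := Iff.rfl

theorem mem_halfSpace_map_mul {f : A →* CoprodI G} {g : CoprodI G} {i : ι} {a b : A} :
    a ∈ halfSpace f (f b * g) i ↔ b⁻¹ * a ∈ halfSpace f g i := by
  simp only [mem_halfSpace, mul_inv_rev, map_mul, map_inv, mul_assoc]

/-- Translation by `b` moves the edge `(g, i)` to `(f b * g, i)`, so the size of the near side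
depends only on the `A`-orbit of the edge. -/
theorem compl_halfSpace_map_mul (f : A →* CoprodI G) (g : CoprodI G) (i : ι) (b : A) :
    (halfSpace f (f b * g) i)ᶜ = (fun a => b * a) '' (halfSpace f g i)ᶜ := by
  ext a
  simp only [Set.image_mul_left, Set.mem_compl_iff, Set.mem_preimage, mem_halfSpace_map_mul]

theorem finite_halfSpace_symmDiff {f : A →* CoprodI G} (hf : Function.Injective f)
    (g : CoprodI G) (i : ι) (s : A) :
    {a | ¬ (a ∈ halfSpace f g i ↔ a * s ∈ halfSpace f g i)}.Finite := by
  refine ((finite_startsIn_symmDiff i (f s)).preimage (f := fun a => g⁻¹ * f a)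
    ((mul_right_injective g⁻¹).comp hf).injOn).subset fun a ha => ?_
  simpa only [mem_halfSpace, map_mul, mul_assoc, Set.mem_preimage, Set.mem_ofPred_eq] using ha

/-- If all edges at the vertex `g G_i` point towards that vertex, then it is fixed. -/
theorem conj_mem_range_of_forall_finite_compl [Infinite A] {f : A →* CoprodI G}
    {g : CoprodI G} {i : ι} (hbig : ∀ h : G i, (halfSpace f (g * of h) i)ᶜ.Finite) (a : A) :
    g⁻¹ * f a * g ∈ (of : G i →* CoprodI G).range := by
  obtain ⟨h, y, hy, hx⟩ := exists_eq_of_mul i (g⁻¹ * f a * g)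
  obtain ⟨k, z, hz, hyz⟩ := exists_eq_of_mul i y⁻¹
  have hzy : z⁻¹ = y * of k := by
    rw [inv_eq_iff_eq_inv, mul_inv_rev, hyz, inv_mul_cancel_left]
  by_cases hy1 : y = 1
  · exact ⟨h, by rw [hx, hy1, mul_one]⟩
  exfalso
  obtain ⟨l, hl⟩ := exists_mem_startsIn hy1
  have hli : l ≠ i := fun e => hy (e ▸ hl)
  have hzl : z⁻¹ ∈ startsIn G l := by
    rcases mul_of_mem_startsIn k hl with h' | ⟨t, ht⟩
    · rwa [hzy]
    · rw [← ht] at hl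
      exact absurd hl (of_notMem_startsIn hli.symm t)
  have e : f a * (g * of k) = g * of h * z⁻¹ := by
    rw [hzy, ← mul_assoc, mul_assoc g, ← mul_assoc (of h), ← hx]
    group
  have h1 := hbig h
  have h2 : (halfSpace f (g * of h * z⁻¹) i)ᶜ.Finite := by
    rw [← e, compl_halfSpace_map_mul]
    exact (hbig k).image _
  -- If `f a` moved the vertex, the end edges of the path to its image would point outwards, giving
  -- two disjoint cofinite half-spaces.
  refine Set.infinite_univ ((h1.union h2).subset fun b _ => ?_)
  by_contra hb
  simp only [Set.mem_union, Set.mem_compl_iff, not_or, not_not, mem_halfSpace] at hb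
  apply hli
  refine eq_of_mem_startsIn ?_ hb.1
  have := mul_mem_startsIn hzl (by rwa [inv_inv]) hb.2
  simpa [mul_assoc] using this

/-- A one-ended subgroup of a free product is conjugate into a factor. -/
theorem IsOneEnded.exists_conj_mem_range [Finite ι] {A : Type u} [Group A] (hA : IsOneEnded A)
    {f : A →* CoprodI G} (hf : Function.Injective f) :
    ∃ (g : CoprodI G) (i : ι), ∀ a, g⁻¹ * f a * g ∈ (of : G i →* CoprodI G).range := by
  have hinf := hA.infinite
  obtain ⟨S, hS, hX⟩ := hA.exists_finite_or_finite_compl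
  have hdich : ∀ g i, (halfSpace f g i).Finite ∨ (halfSpace f g i)ᶜ.Finite := fun g i =>
    hX _ fun s _ => finite_halfSpace_symmDiff hf g i s
  have hexists : ∀ g, ∃ i, (halfSpace f g i)ᶜ.Finite := by
    intro g
    by_contra! h
    have hfin : ∀ i, (halfSpace f g i).Finite := fun i => (hdich g i).resolve_right (h i)
    have h1 : {a | f a = g}.Finite :=
      Set.Subsingleton.finite fun a ha b hb => hf (ha.trans hb.symm)
    refine Set.infinite_univ (((Set.finite_iUnion hfin).union h1).subset fun a _ => ?_)
    by_cases ha : g⁻¹ * f a = 1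
    · exact Or.inr (inv_mul_eq_one.1 ha).symm
    · obtain ⟨i, hi⟩ := exists_mem_startsIn ha
      exact Or.inl (Set.mem_iUnion.2 ⟨i, hi⟩)
  -- Orient each edge towards its cofinite side. An edge with both sides nonempty has a translate
  -- separating `1` from some `f s` with `s ∈ S`, so only finitely many sizes occur.
  let V : Set ℕ := {n | ∃ g i, (halfSpace f g i)ᶜ.Finite ∧ (halfSpace f g i)ᶜ.Nonempty ∧
    (halfSpace f g i)ᶜ.ncard = n}
  have hVfin : V.Finite := by
    have hF : (⋃ s ∈ S, ⋃ i, {g : CoprodI G | ¬ (g ∈ startsIn G i ↔ g * f s ∈ startsIn G i)}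
        ×ˢ {i}).Finite :=
      S.finite_toSet.biUnion fun s _ => Set.finite_iUnion fun i =>
        (finite_startsIn_symmDiff i (f s)).prod (Set.finite_singleton i)
    refine (hF.image fun p => (halfSpace f p.1⁻¹ p.2)ᶜ.ncard).subset ?_
    rintro _ ⟨g, i, hfin, ⟨c, hc⟩, rfl⟩
    obtain ⟨b, hb⟩ : (halfSpace f g i).Nonempty := by
      rw [Set.nonempty_iff_ne_empty]
      intro he
      rw [he, Set.compl_empty] at hfin
      exact Set.infinite_univ hfin
    obtain ⟨s, hs, a, ha⟩ : ∃ s ∈ S, ∃ a, ¬ (a ∈ halfSpace f g i ↔ a * s ∈ halfSpace f g i) := by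
      by_contra! h
      have hinv : ∀ x a, a ∈ halfSpace f g i ↔ a * x ∈ halfSpace f g i := by
        intro x
        have hx : x ∈ Subgroup.closure (S : Set A) := hS ▸ Subgroup.mem_top x
        induction hx using Subgroup.closure_induction with
        | mem s hs => exact h s hs
        | one => simp
        | mul x y _ _ hx hy => intro a; rw [hx, hy, mul_assoc]
        | inv x _ hx => intro a; rw [hx (a * x⁻¹), inv_mul_cancel_right]
      apply hc
      have := (hinv (b⁻¹ * c) b).1 hb
      rwa [mul_inv_cancel_left] at this
    refine ⟨(g⁻¹ * f a, i), ?_, ?_⟩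
    · simp only [Set.mem_iUnion]
      refine ⟨s, hs, i, ?_, rfl⟩
      simpa only [mem_halfSpace, map_mul, mul_assoc, Set.mem_ofPred_eq] using ha
    · have e : (g⁻¹ * f a)⁻¹ = f a⁻¹ * g := by simp
      simp only
      rw [e, compl_halfSpace_map_mul, Set.ncard_image_of_injective _ (mul_right_injective _)]
  obtain ⟨i₀, hi₀⟩ := hexists 1
  have hV₀ : (halfSpace f 1 i₀)ᶜ.Nonempty := ⟨1, by
    simpa [mem_halfSpace] using one_notMem_startsIn i₀⟩
  obtain ⟨M, ⟨g, i, hfin, hne, hM⟩, hmax⟩ :=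
    Set.exists_max_image V id hVfin ⟨_, 1, i₀, hi₀, hV₀, rfl⟩
  obtain ⟨x, hx⟩ : (halfSpace f g i).Nonempty := by
    rw [Set.nonempty_iff_ne_empty]
    intro he
    rw [he, Set.compl_empty] at hfin
    exact Set.infinite_univ hfin
  -- Follow the arrows from an edge with largest finite side. By maximality that side cannot grow,
  -- so `x` stays ahead while its distance drops; the walk must stop at a sink.
  induction hn : wordLength (g⁻¹ * f x) generalizing g i with
  | zero =>
    obtain ⟨t, y, hy, e⟩ := exists_eq_of_mul i (g⁻¹ * f x)
    have ht : t ≠ 1 := by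
      rintro rfl
      rw [map_one, one_mul] at e
      exact hy (e ▸ hx)
    rw [e, wordLength_of_mul ht hy] at hn
    omega
  | succ n ih =>
    by_cases hsink : ∀ h : G i, (halfSpace f (g * of h) i)ᶜ.Finite
    · exact ⟨g, i, conj_mem_range_of_forall_finite_compl hsink⟩
    push Not at hsink
    obtain ⟨h, hh⟩ := hsink
    have hh1 : h ≠ 1 := by
      rintro rfl
      rw [map_one, mul_one] at hh
      exact hh hfin
    obtain ⟨j, hj⟩ := hexists (g * of h)
    have hji : j ≠ i := fun e => hh (e ▸ hj)
    have hnot : ∀ a ∈ halfSpace f (g * of h) j, (of h)⁻¹ * (g⁻¹ * f a) ∉ startsIn G i := by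
      intro a ha ha'
      rw [mem_halfSpace, mul_inv_rev, mul_assoc] at ha
      exact hji (eq_of_mem_startsIn ha ha')
    have hsub : halfSpace f (g * of h) j ⊆ halfSpace f g i := fun a ha => by
      have := of_mul_mem_startsIn hh1 (hnot a ha)
      rwa [mul_inv_cancel_left] at this
    have hsub' := Set.compl_subset_compl.2 hsub
    have hle : (halfSpace f (g * of h) j)ᶜ.ncard ≤ M :=
      hmax _ ⟨_, _, hj, hne.mono hsub', rfl⟩
    have heq := Set.eq_of_subset_of_ncard_le hsub' (hM ▸ hle) hj
    have hx' : x ∈ halfSpace f (g * of h) j := by rwa [← compl_inj_iff.1 heq]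
    refine ih _ j hj (hne.mono hsub') (heq ▸ hM) hx' ?_
    have := wordLength_of_mul hh1 (hnot x hx')
    rw [mul_inv_cancel_left] at this
    rw [mul_inv_rev, mul_assoc]
    omega

end Elliptic

/-! ### Comparing two actions through their stabilizers. -/

/-- If the point stabilizers of two actions are nontrivial, intersect trivially, and are contained
in one another, then the actions are isomorphic. -/
theorem MulAction.exists_equiv_of_stabilizer_le {K X Y : Type*} [Group K] [MulAction K X]
    [MulAction K Y] (hXY : ∀ x : X, ∃ y : Y, stabilizer K x ≤ stabilizer K y)
    (hYX : ∀ y : Y, ∃ x : X, stabilizer K y ≤ stabilizer K x)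
    (hX : ∀ x : X, ∃ k : K, k ≠ 1 ∧ k • x = x) (hY : ∀ y : Y, ∃ k : K, k ≠ 1 ∧ k • y = y)
    (hX' : ∀ (k : K) (x x' : X), k ≠ 1 → k • x = x → k • x' = x' → x = x')
    (hY' : ∀ (k : K) (y y' : Y), k ≠ 1 → k • y = y → k • y' = y' → y = y') :
    ∃ e : X ≃ Y, ∀ (k : K) (x : X), e (k • x) = k • e x := by
  choose φ hφ using hXY
  choose ψ hψ using hYX
  -- A nontrivial element fixing `x` also fixes `ψ (φ x)`, and its fixed point is unique.
  -- Equivariance follows likewise from a conjugate fixing both `φ (k • x)` and `k • φ x`.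
  refine ⟨⟨φ, ψ, fun x => ?_, fun y => ?_⟩, fun k x => ?_⟩
  · obtain ⟨k, hk1, hk⟩ := hX x
    exact hX' k _ _ hk1 (hψ _ (hφ _ hk)) hk
  · obtain ⟨k, hk1, hk⟩ := hY y
    exact hY' k _ _ hk1 (hφ _ (hψ _ hk)) hk
  · obtain ⟨l, hl1, hl⟩ := hX x
    refine hY' (k * l * k⁻¹) _ _ (by simpa using hl1) (hφ _ ?_) ?_
    · rw [mem_stabilizer_iff]
      rw [smul_smul, inv_mul_cancel_right, mul_smul, hl]
    · have := hφ _ hl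
      rw [mem_stabilizer_iff] at this
      change (k * l * k⁻¹) • k • φ x = k • φ x
      rw [smul_smul, inv_mul_cancel_right, mul_smul, this]

/-! ### The action on cosets of factors, and its weighted orbit count. -/

section FactorCosets

variable {ι : Type*} {G : ι → Type*} [∀ i, Group (G i)] {K : Type*} [Group K]

/-- The cosets of the factors of a free product, as a set with an action of a group `K` mapping
to the free product. These are the vertices of the Bass–Serre tree with nontrivial stabilizer. -/
def FactorCosets (_j : K →* CoprodI G) : Type _ :=
  Σ i, CoprodI G ⧸ (of : G i →* CoprodI G).range

namespace FactorCosets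

variable (j : K →* CoprodI G)

instance : MulAction K (FactorCosets j) :=
  MulAction.compHom (Σ i, CoprodI G ⧸ (of : G i →* CoprodI G).range) j

/-- The coset of `g` of the factor `i`. -/
def mk (i : ι) (g : CoprodI G) : FactorCosets j := ⟨i, (g : CoprodI G ⧸ (of : G i →* _).range)⟩

variable {j}

theorem exists_eq_mk (q : FactorCosets j) : ∃ i g, q = mk j i g := by
  obtain ⟨i, x⟩ := q
  obtain ⟨g, rfl⟩ := QuotientGroup.mk_surjective x
  exact ⟨i, g, rfl⟩

theorem smul_mk (k : K) (i : ι) (g : CoprodI G) : k • mk j i g = mk j i (j k * g) := rfl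

theorem mk_eq_mk {i : ι} {g g' : CoprodI G} :
    mk j i g = mk j i g' ↔ g⁻¹ * g' ∈ (of : G i →* CoprodI G).range := by
  rw [← QuotientGroup.eq]
  exact ⟨fun h => eq_of_heq (Sigma.mk.inj h).2, fun h => congrArg (Sigma.mk i) h⟩

theorem index_eq_of_mk_eq_mk {i i' : ι} {g g' : CoprodI G} (h : mk j i g = mk j i' g') : i = i' :=
  congrArg Sigma.fst h

theorem mk_mul_of (i : ι) (g : CoprodI G) (h : G i) : mk j i (g * of h) = mk j i g :=
  mk_eq_mk.2 ⟨h⁻¹, by simp⟩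

theorem smul_mk_eq_iff {k : K} {i : ι} {g : CoprodI G} :
    k • mk j i g = mk j i g ↔ g⁻¹ * j k * g ∈ (of : G i →* CoprodI G).range := by
  rw [smul_mk, eq_comm, mk_eq_mk, mul_assoc]

theorem eq_of_smul_eq (hj : Function.Injective j) {k : K} (hk : k ≠ 1) {q q' : FactorCosets j}
    (hq : k • q = q) (hq' : k • q' = q') : q = q' := by
  obtain ⟨i, g, rfl⟩ := exists_eq_mk q
  obtain ⟨i', g', rfl⟩ := exists_eq_mk q'
  rw [smul_mk_eq_iff] at hq hq'
  obtain ⟨h, hh⟩ := hq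
  obtain ⟨h', hh'⟩ := hq'
  have h1 : h ≠ 1 := by
    rintro rfl
    apply hk
    apply hj
    rw [map_one, eq_comm, mul_assoc, inv_mul_eq_one] at hh
    simpa using hh.symm
  obtain ⟨rfl, hx⟩ := eq_of_of_mul_eq_mul_of (x := g⁻¹ * g') h1 (k := h') (by rw [hh, hh']; group)
  exact mk_eq_mk.2 hx

variable (j) in
/-- The elements of the factor `i` whose conjugate by `g` lies in the image of `j`. -/
def factorSubgroup (i : ι) (g : CoprodI G) : Subgroup (G i) :=
  j.range.comap ((MulAut.conj g).toMonoidHom.comp of)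

theorem mem_factorSubgroup {i : ι} {g : CoprodI G} {h : G i} :
    h ∈ factorSubgroup j i g ↔ g * of h * g⁻¹ ∈ j.range := Iff.rfl

instance [j.range.FiniteIndex] (i : ι) (g : CoprodI G) : (factorSubgroup j i g).FiniteIndex :=
  ⟨by
    rw [factorSubgroup, Subgroup.index_comap]
    exact (inferInstance : (Subgroup.subgroupOf _ _).FiniteIndex).index_ne_zero⟩

/-- Both groups embed in the free product with image the intersection of `j.range` with the
conjugate by `g` of factor `i`. -/
theorem nonempty_stabilizer_mulEquiv (hj : Function.Injective j) (i : ι) (g : CoprodI G) :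
    Nonempty (MulAction.stabilizer K (mk j i g) ≃* factorSubgroup j i g) := by
  have hθ : Function.Injective ((MulAut.conj g).toMonoidHom.comp (of : G i →* CoprodI G)) :=
    (MulAut.conj g).injective.comp (of_injective i)
  have e : (MulAction.stabilizer K (mk j i g)).map j =
      (factorSubgroup j i g).map ((MulAut.conj g).toMonoidHom.comp of) := by
    ext x
    constructor
    · rintro ⟨k, hk, rfl⟩
      obtain ⟨h, hh⟩ := smul_mk_eq_iff.1 (MulAction.mem_stabilizer_iff.1 hk)
      have : g * of h * g⁻¹ = j k := by rw [hh]; group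
      exact ⟨h, mem_factorSubgroup.2 ⟨k, this.symm⟩, this⟩
    · rintro ⟨h, ⟨k, hk⟩, rfl⟩
      refine ⟨k, smul_mk_eq_iff.2 ⟨h, ?_⟩, hk⟩
      rw [hk]
      simp [mul_assoc]
  exact ⟨((Subgroup.equivMapOfInjective _ j hj).trans (MulEquiv.subgroupCongr e)).trans
    (Subgroup.equivMapOfInjective _ _ hθ).symm⟩

/-- Counting double cosets of the image of `j` and a factor. -/
theorem card_fiber_eq_index (i : ι) (g : CoprodI G) :
    Nat.card {p : ι × Quotient (QuotientGroup.rightRel j.range) //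
      ∃ x, p.2 = Quotient.mk _ x ∧ ∃ k : K, k • mk j i g = mk j p.1 x} =
      (factorSubgroup j i g).index := by
  rw [Subgroup.index, ← Nat.card_congr
    (QuotientGroup.quotientRightRelEquivQuotientLeftRel (factorSubgroup j i g))]
  symm
  have hrel : ∀ h h' : G i, QuotientGroup.rightRel (factorSubgroup j i g) h h' ↔
      QuotientGroup.rightRel j.range (g * of h) (g * of h') := by
    intro h h'
    rw [QuotientGroup.rightRel_apply, QuotientGroup.rightRel_apply, mem_factorSubgroup]
    simp only [map_mul, map_inv, mul_inv_rev, mul_assoc]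
  -- The double coset of `g` splits into right cosets of `j.range` represented by the elements `g *
  -- of h`.
  let F : Quotient (QuotientGroup.rightRel (factorSubgroup j i g)) →
      {p : ι × Quotient (QuotientGroup.rightRel j.range) //
        ∃ x, p.2 = Quotient.mk _ x ∧ ∃ k : K, k • mk j i g = mk j p.1 x} :=
    Quotient.lift (fun h => ⟨(i, Quotient.mk _ (g * of h)), _, rfl, 1, by
      rw [one_smul, mk_mul_of]⟩) fun h h' hh =>
        Subtype.ext (Prod.ext rfl (Quotient.sound ((hrel h h').1 hh)))
  refine Nat.card_congr (Equiv.ofBijective F ⟨?_, ?_⟩)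
  · intro a b hab
    induction a using Quotient.inductionOn with | _ h
    induction b using Quotient.inductionOn with | _ h'
    have := congrArg (fun p => p.1.2) hab
    exact Quotient.sound ((hrel h h').2 (Quotient.exact this))
  · rintro ⟨⟨i', c⟩, x, hc, k, hk⟩
    dsimp only at hc hk
    subst hc
    rw [smul_mk] at hk
    obtain rfl := index_eq_of_mk_eq_mk hk
    obtain ⟨h, hh⟩ := mk_eq_mk.1 hk
    refine ⟨Quotient.mk _ h, Subtype.ext (Prod.ext rfl (Quotient.sound ?_))⟩
    change QuotientGroup.rightRel j.range _ _
    rw [QuotientGroup.rightRel_apply]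
    refine ⟨k, ?_⟩
    rw [hh]
    group

/-- Sum `r` over pairs of a factor and a right coset of `j.range`, then group the pairs by
`K`-orbit: the fibre over the orbit of `mk j i g` has `(factorSubgroup j i g).index` elements. -/
theorem finsum_orbit [Fintype ι] [j.range.FiniteIndex] (w : FactorCosets j → ℝ) (r : ι → ℝ)
    (hw : ∀ i g, w (mk j i g) = (factorSubgroup j i g).index * r i) :
    ∑ᶠ o : MulAction.orbitRel.Quotient K (FactorCosets j), w o.out =
      j.range.index * ∑ i, r i := by
  classical
  let R := Quotient (QuotientGroup.rightRel j.range)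
  let eR : R ≃ CoprodI G ⧸ j.range := QuotientGroup.quotientRightRelEquivQuotientLeftRel _
  let _ : Fintype R := @Fintype.ofFinite _ (Finite.of_equiv _ eR.symm)
  let π : ι × R → MulAction.orbitRel.Quotient K (FactorCosets j) := fun p =>
    Quotient.lift (fun g => (Quotient.mk _ (mk j p.1 g) :
      MulAction.orbitRel.Quotient K (FactorCosets j))) (fun g g' h => Quotient.sound (by
        change QuotientGroup.rightRel j.range _ _ at h
        rw [QuotientGroup.rightRel_apply] at h
        obtain ⟨k, hk⟩ := h
        exact ⟨k⁻¹, by simp [smul_mk, hk]⟩)) p.2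
  have hπ : Function.Surjective π := by
    intro o
    induction o using Quotient.inductionOn with | _ q
    obtain ⟨i, g, rfl⟩ := exists_eq_mk q
    exact ⟨(i, Quotient.mk _ g), rfl⟩
  have hfib : ∀ i g p, π p = Quotient.mk _ (mk j i g) ↔
      ∃ x, p.2 = Quotient.mk _ x ∧ ∃ k : K, k • mk j i g = mk j p.1 x := by
    rintro i g ⟨i', c⟩
    induction c using Quotient.inductionOn with | _ x
    constructor
    · intro h
      obtain ⟨k, hk⟩ := Quotient.exact h
      exact ⟨x, rfl, k, hk⟩
    · rintro ⟨y, hy, k, hk⟩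
      dsimp only at hy
      rw [hy]
      exact Quotient.sound ⟨k, hk⟩
  have hfin : Finite (MulAction.orbitRel.Quotient K (FactorCosets j)) := Finite.of_surjective π hπ
  let _ := Fintype.ofFinite (MulAction.orbitRel.Quotient K (FactorCosets j))
  rw [finsum_eq_sum_of_fintype]
  have h1 : ∑ p : ι × R, r p.1 = j.range.index * ∑ i, r i := by
    rw [Fintype.sum_prod_type]
    simp only [Finset.sum_const, Finset.card_univ, nsmul_eq_mul]
    rw [← Finset.mul_sum, ← Nat.card_eq_fintype_card, Nat.card_congr eR]
    rfl
  rw [← h1, ← Finset.sum_fiberwise Finset.univ π]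
  refine Finset.sum_congr rfl fun o _ => ?_
  obtain ⟨i, g, hq⟩ := exists_eq_mk o.out
  have ho : o = Quotient.mk _ (mk j i g) := by rw [← hq, Quotient.out_eq]
  rw [hq, hw, ← card_fiber_eq_index]
  have hconst : ∀ p ∈ Finset.univ.filter (fun p => π p = o), r p.1 = r i := by
    intro p hp
    rw [Finset.mem_filter, ho, hfib] at hp
    obtain ⟨-, x, -, k, hk⟩ := hp
    rw [smul_mk] at hk
    rw [index_eq_of_mk_eq_mk hk]
  rw [Finset.sum_congr rfl hconst, Finset.sum_const, nsmul_eq_mul]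
  congr 2
  rw [← Fintype.card_subtype, ← Nat.card_eq_fintype_card]
  refine Nat.card_congr (Equiv.subtypeEquivRight fun p => ?_)
  rw [ho, hfib]

end FactorCosets

end FactorCosets

/-! ### Recovering the index by counting affine functions. -/

/-- The functions on a set with an action of `K` that every element of `K` changes by a
constant. -/
def affineFunctions (K X : Type*) [Group K] [MulAction K X] : Set (X → ZMod 2) :=
  {F | ∃ φ : K → ZMod 2, ∀ k x, F (k • x) = F x + φ k}

theorem card_affineFunctions_congr {K X Y : Type*} [Group K] [MulAction K X] [MulAction K Y]
    (e : X ≃ Y) (he : ∀ (k : K) (x : X), e (k • x) = k • e x) :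
    Nat.card (affineFunctions K X) = Nat.card (affineFunctions K Y) := by
  refine (Nat.card_congr ((Equiv.arrowCongr e.symm (Equiv.refl (ZMod 2))).subtypeEquiv
    fun F => ?_)).symm
  constructor
  · rintro ⟨φ, hφ⟩
    exact ⟨φ, fun k x => by simp [he, hφ]⟩
  · rintro ⟨φ, hφ⟩
    refine ⟨φ, fun k y => ?_⟩
    have := hφ k (e.symm y)
    simpa [he] using this

section Cocycle

variable {ι : Type*} {G : ι → Type*} [∀ i, Group (G i)]

theorem Monoid.CoprodI.apply_mul_eq_of_forall_of {α : Type*} {δ : CoprodI G → α}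
    (h : ∀ i g (x : G i), δ (g * of x) = δ g) (g x : CoprodI G) : δ (g * x) = δ g := by
  induction x using CoprodI.induction_on generalizing g with
  | one => rw [mul_one]
  | of i x => exact h i g x
  | mul x y hx hy => rw [← mul_assoc, hy, hx]

/-- A function on a free product with prescribed increments along right multiplication by
elements of the factors. -/
theorem Monoid.CoprodI.exists_forall_mul_of_eq {R : Type*} [AddCommGroup R]
    (d : ι → CoprodI G → R) (c : R) :
    ∃ f : CoprodI G → R, f 1 = c ∧
      ∀ i g (h : G i), f (g * of h) = f g + d i g - d i (g * of h) := by
  -- Each factor acts on pairs (position, value) by right translation with the prescribed increment.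
  -- The increments telescope, so the universal property yields an action of the free product.
  let act : ∀ i, G i →* Function.End (CoprodI G × R) := fun i =>
    { toFun := fun h p => (p.1 * of h⁻¹, p.2 + d i p.1 - d i (p.1 * of h⁻¹))
      map_one' := by
        funext p
        change (_, _) = p
        simp
      map_mul' := fun h h' => by
        funext p
        change (_, _) = (p.1 * of h'⁻¹ * of h⁻¹, p.2 + d i p.1 - d i (p.1 * of h'⁻¹) +
          d i (p.1 * of h'⁻¹) - d i (p.1 * of h'⁻¹ * of h⁻¹))
        simp [mul_assoc] }
  let Ψ := CoprodI.lift act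
  have hΨ_one : ∀ p, Ψ 1 p = p := fun p => by
    rw [map_one]
    rfl
  have hΨ_mul : ∀ x y p, Ψ (x * y) p = Ψ x (Ψ y p) := fun x y p => by
    rw [map_mul]
    rfl
  have hΨ_of : ∀ i (h : G i) p,
      Ψ (of h) p = (p.1 * of h⁻¹, p.2 + d i p.1 - d i (p.1 * of h⁻¹)) := fun i h p => by
    rw [lift_of]
    rfl
  have hfst : ∀ x p, (Ψ x p).1 = p.1 * x⁻¹ := by
    intro x
    induction x using CoprodI.induction_on with
    | one => intro p; rw [hΨ_one, inv_one, mul_one]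
    | of i h => intro p; rw [hΨ_of, map_inv]
    | mul x y hx hy => intro p; rw [hΨ_mul, hx, hy, mul_inv_rev, mul_assoc]
  refine ⟨fun x => (Ψ x⁻¹ (1, c)).2, by simp only [inv_one, hΨ_one], fun i g h => ?_⟩
  have hg : (Ψ g⁻¹ (1, c)).1 = g := by rw [hfst, one_mul, inv_inv]
  dsimp only
  rw [mul_inv_rev, hΨ_mul, ← map_inv, hΨ_of, hg, inv_inv]

end Cocycle

namespace FactorCosets

variable {ι : Type*} {G : ι → Type*} [∀ i, Group (G i)] {K : Type*} [Group K]

/-- An affine `F` is determined by `F (mk j i₀ 1)` and the differences `F (mk j i g) - F (mk j i₀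
g)` for `i ≠ i₀`. These are `K`-invariant in `g`, hence functions on right cosets of `j.range`, and
can be prescribed freely. -/
theorem card_affineFunctions [Finite ι] [Nonempty ι] (j : K →* CoprodI G) [j.range.FiniteIndex] :
    Nat.card (affineFunctions K (FactorCosets j)) =
      2 ^ (1 + j.range.index * (Nat.card ι - 1)) := by
  classical
  obtain ⟨i₀⟩ := ‹Nonempty ι›
  let R := Quotient (QuotientGroup.rightRel j.range)
  let eR : R ≃ CoprodI G ⧸ j.range := QuotientGroup.quotientRightRelEquivQuotientLeftRel _
  have hR : Finite R := Finite.of_equiv _ eR.symm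
  let Φ : affineFunctions K (FactorCosets j) → ZMod 2 × ({i // i ≠ i₀} → R → ZMod 2) := fun F =>
    (F.1 (mk j i₀ 1), fun i => Quotient.lift (fun g => F.1 (mk j i g) - F.1 (mk j i₀ g))
      fun g g' h => by
        change QuotientGroup.rightRel j.range _ _ at h
        rw [QuotientGroup.rightRel_apply] at h
        obtain ⟨k, hk⟩ := h
        obtain ⟨φ, hφ⟩ := F.2
        obtain rfl : g' = j k * g := by rw [hk, inv_mul_cancel_right]
        rw [← smul_mk, ← smul_mk, hφ, hφ]
        ring)
  have hΦ : Function.Bijective Φ := by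
    constructor
    · intro F F' h
      have h1 : F.1 (mk j i₀ 1) = F'.1 (mk j i₀ 1) := congrArg Prod.fst h
      have h2 : ∀ i g, F.1 (mk j i g) - F'.1 (mk j i g) =
          F.1 (mk j i₀ g) - F'.1 (mk j i₀ g) := by
        intro i g
        by_cases hi : i = i₀
        · rw [hi]
        · have : F.1 (mk j i g) - F.1 (mk j i₀ g) = F'.1 (mk j i g) - F'.1 (mk j i₀ g) :=
            congrFun (congrFun (congrArg Prod.snd h) ⟨i, hi⟩) (Quotient.mk _ g)
          rw [sub_eq_sub_iff_add_eq_add] at this ⊢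
          rw [this]
          ring
      have h3 : ∀ g, F.1 (mk j i₀ g) - F'.1 (mk j i₀ g) = 0 := by
        intro g
        have := apply_mul_eq_of_forall_of
          (δ := fun g => F.1 (mk j i₀ g) - F'.1 (mk j i₀ g))
          (fun i g x => by rw [← h2 i, mk_mul_of, h2]) 1 g
        simpa [h1] using this
      refine Subtype.ext (funext fun q => ?_)
      obtain ⟨i, g, rfl⟩ := exists_eq_mk q
      exact sub_eq_zero.1 ((h2 i g).trans (h3 g))
    · rintro ⟨c, D⟩
      let d : ι → CoprodI G → ZMod 2 := fun i g =>
        if hi : i ≠ i₀ then D ⟨i, hi⟩ (Quotient.mk _ g) else 0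
      have hd₀ : ∀ g, d i₀ g = 0 := fun g => dif_neg (not_not.2 rfl)
      have hdK : ∀ i k g, d i (j k * g) = d i g := by
        intro i k g
        have : (Quotient.mk _ (j k * g) : R) = Quotient.mk _ g :=
          Quotient.sound (QuotientGroup.rightRel_apply.2 ⟨k⁻¹, by simp⟩)
        simp only [d, this]
      obtain ⟨f, hf1, hf⟩ := exists_forall_mul_of_eq d c
      have hfK : ∀ k g, f (j k * g) = f g + (f (j k) - c) := by
        intro k g
        have := apply_mul_eq_of_forall_of (δ := fun g => f (j k * g) - f g)
          (fun i g x => by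
            rw [← mul_assoc, hf, hf, mul_assoc, hdK, hdK]
            ring) 1 g
        simp only [one_mul, mul_one, hf1] at this
        rw [← this]
        ring
      let F : FactorCosets j → ZMod 2 := fun q =>
        Quotient.lift (s := QuotientGroup.leftRel _) (fun g => f g + d q.1 g) (fun g g' h => by
          change QuotientGroup.leftRel _ _ _ at h
          rw [QuotientGroup.leftRel_apply] at h
          obtain ⟨x, hx⟩ := h
          obtain rfl : g' = g * of x := by rw [hx, mul_inv_cancel_left]
          rw [hf]
          ring) q.2
      have hF : ∀ i g, F (mk j i g) = f g + d i g := fun i g => rfl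
      refine ⟨⟨F, fun k => f (j k) - c, fun k q => ?_⟩, Prod.ext ?_ (funext fun i => funext fun x => ?_)⟩
      · obtain ⟨i, g, rfl⟩ := exists_eq_mk q
        rw [smul_mk, hF, hF, hfK, hdK]
        ring
      · change F (mk j i₀ 1) = c
        rw [hF, hf1, hd₀, add_zero]
      · induction x using Quotient.inductionOn with | _ g
        change F (mk j i g) - F (mk j i₀ g) = _
        rw [hF, hF, hd₀]
        simp [d, i.2]
  rw [Nat.card_congr (Equiv.ofBijective Φ hΦ), Nat.card_prod, Nat.card_fun, Nat.card_fun,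
    Nat.card_zmod, Nat.card_congr eR, ← pow_mul, pow_add, pow_one, Subgroup.index]
  congr 3
  let _ := Fintype.ofFinite ι
  rw [Nat.card_eq_fintype_card, Nat.card_eq_fintype_card, Fintype.card_subtype_compl,
    Fintype.card_subtype_eq]

end FactorCosets

/-! ### Recovering the total invariant. -/

theorem MulAction.finsum_stabilizer_congr {K X Y : Type*} [Group K] [MulAction K X]
    [MulAction K Y] (e : X ≃ Y) (he : ∀ (k : K) (x : X), e (k • x) = k • e x)
    (v : Subgroup K → ℝ) (hv : ∀ P Q : Subgroup K, Nonempty (P ≃* Q) → v P = v Q) :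
    ∑ᶠ o : orbitRel.Quotient K X, v (stabilizer K o.out) =
      ∑ᶠ o : orbitRel.Quotient K Y, v (stabilizer K o.out) := by
  have hrel : ∀ x x' : X, orbitRel K X x x' ↔ orbitRel K Y (e x) (e x') := by
    intro x x'
    simp only [orbitRel_apply, mem_orbit_iff, ← he, e.apply_eq_iff_eq]
  let E : orbitRel.Quotient K X ≃ orbitRel.Quotient K Y := Quotient.congr e hrel
  rw [← finsum_comp_equiv E]
  refine finsum_congr fun o => ?_
  have hE : E o = Quotient.mk _ (e o.out) := by
    conv_lhs => rw [← Quotient.out_eq o]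
    rfl
  have hout : orbitRel K Y (e o.out) (E o).out :=
    Quotient.exact (hE.symm.trans (Quotient.out_eq (E o)).symm)
  have hstab : stabilizer K (e o.out) = stabilizer K o.out := by
    ext k
    rw [mem_stabilizer_iff, mem_stabilizer_iff, ← he, e.apply_eq_iff_eq]
  rw [← hstab]
  -- The two representatives may differ, but they share an orbit, so their stabilizers are
  -- isomorphic.
  exact hv _ _ ⟨stabilizerEquivStabilizerOfOrbitRel hout⟩

theorem FactorCosets.exists_le_stabilizer {ι : Type*} [Finite ι] {G : ι → Type*}
    [∀ i, Group (G i)] {K : Type*} [Group K] {j : K →* CoprodI G} (hj : Function.Injective j)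
    {P : Subgroup K} {B : Type u} [Group B] (hB : IsOneEnded B) (e : P ≃* B) :
    ∃ q : FactorCosets j, P ≤ MulAction.stabilizer K q := by
  obtain ⟨g, i, h⟩ := hB.exists_conj_mem_range
    (f := (j.comp P.subtype).comp e.symm.toMonoidHom)
    ((hj.comp P.subtype_injective).comp e.symm.injective)
  refine ⟨mk j i g, fun k hk => smul_mk_eq_iff.2 ?_⟩
  simpa using h (e ⟨k, hk⟩)

theorem FactorCosets.exists_smul_eq {ι : Type*} {G : ι → Type*}
    [∀ i, Group (G i)] {K : Type*} [Group K] {j : K →* CoprodI G} (q : FactorCosets j)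
    {B : Type u} [Group B] (hB : IsOneEnded B) (e : MulAction.stabilizer K q ≃* B) :
    ∃ k : K, k ≠ 1 ∧ k • q = q := by
  have := hB.infinite
  obtain ⟨b, hb⟩ := exists_ne (1 : B)
  refine ⟨e.symm b, fun h => hb ?_, (e.symm b).2⟩
  simpa using h

/-- The extension of the absolute value of an invariant to the groups isomorphic to a member of
the family. -/
noncomputable def absInvariant (C : (G : Type u) → [Group G] → Prop)
    (ρ : (G : Type u) → [Group G] → ℝ) (A : Type u) [Group A] : ℝ :=
  open Classical in
  -- `C` need not be closed under isomorphism, and stabilizers are only isomorphic to members; `0`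
  -- is a junk value.
  if h : ∃ (B : Type u) (_ : Group B), C B ∧ Nonempty (A ≃* B) then
    |@ρ h.choose h.choose_spec.choose| else 0

section Invariant

variable {C : (G : Type u) → [Group G] → Prop} {ρ : (G : Type u) → [Group G] → ℝ}

theorem IsMultiplicativeInvariant.absInvariant_eq (hρ : IsMultiplicativeInvariant C ρ)
    {A B : Type u} [Group A] [Group B] (hB : C B) (e : A ≃* B) : absInvariant C ρ A = |ρ B| := by
  have h : ∃ (B : Type u) (_ : Group B), C B ∧ Nonempty (A ≃* B) := ⟨B, _, hB, ⟨e⟩⟩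
  rw [absInvariant, dif_pos h]
  let _ : Group h.choose := h.choose_spec.choose
  obtain ⟨hC, ⟨e'⟩⟩ := h.choose_spec.choose_spec
  exact congrArg _ (hρ.map_mulEquiv _ _ hC hB (e'.symm.trans e))

theorem IsMultiplicativeInvariant.absInvariant_congr (hρ : IsMultiplicativeInvariant C ρ)
    {A A' : Type u} [Group A] [Group A'] (e : A ≃* A') :
    absInvariant C ρ A = absInvariant C ρ A' := by
  by_cases h : ∃ (B : Type u) (_ : Group B), C B ∧ Nonempty (A ≃* B)
  · obtain ⟨B, _, hB, ⟨f⟩⟩ := h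
    rw [hρ.absInvariant_eq hB f, hρ.absInvariant_eq hB (e.symm.trans f)]
  · have h' : ¬ ∃ (B : Type u) (_ : Group B), C B ∧ Nonempty (A' ≃* B) := by
      rintro ⟨B, _, hB, ⟨f⟩⟩
      exact h ⟨B, _, hB, ⟨e.trans f⟩⟩
    rw [absInvariant, absInvariant, dif_neg h, dif_neg h']

theorem IsMultiplicativeInvariant.finsum_absInvariant_stabilizer
    (hρ : IsMultiplicativeInvariant C ρ) (hC : ClosedUnderFiniteIndex C) {ι : Type} [Fintype ι]
    {G : ι → Type u} [∀ i, Group (G i)] (hG : ∀ i, C (G i)) {K : Type u} [Group K]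
    {j : K →* CoprodI G} (hj : Function.Injective j) [j.range.FiniteIndex] :
    ∑ᶠ o : MulAction.orbitRel.Quotient K (FactorCosets j),
      absInvariant C ρ (MulAction.stabilizer K o.out) = j.range.index * ∑ i, |ρ (G i)| := by
  refine FactorCosets.finsum_orbit (fun q => absInvariant C ρ (MulAction.stabilizer K q)) _
    fun i g => ?_
  obtain ⟨e⟩ := FactorCosets.nonempty_stabilizer_mulEquiv hj i g
  have hfi : (FactorCosets.factorSubgroup j i g).FiniteIndex := inferInstance
  rw [hρ.absInvariant_eq (hC _ (hG i) _ hfi) e, hρ.map_subgroup _ (hG i) _ hfi, abs_mul,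
    Nat.abs_cast]

/-- Two realizations of a group as a finite-index subgroup of free products of the same number of
members of the family give the same total invariant. -/
theorem IsMultiplicativeInvariant.sum_abs_eq (hρ : IsMultiplicativeInvariant C ρ)
    (hC : ClosedUnderFiniteIndex C) (hends : ∀ (G : Type u) [Group G], C G → IsOneEnded G)
    {ι : Type} [Fintype ι] [Nontrivial ι] {G H : ι → Type u} [∀ i, Group (G i)]
    [∀ i, Group (H i)] (hG : ∀ i, C (G i)) (hH : ∀ i, C (H i)) {K : Type u} [Group K]
    {j : K →* CoprodI G} {l : K →* CoprodI H} (hj : Function.Injective j)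
    (hl : Function.Injective l) [j.range.FiniteIndex] [l.range.FiniteIndex] :
    ∑ i, |ρ (G i)| = ∑ i, |ρ (H i)| := by
  have stab : ∀ {L : ι → Type u} [∀ i, Group (L i)] (_ : ∀ i, C (L i)) {f : K →* CoprodI L}
      (_ : Function.Injective f) [f.range.FiniteIndex] (q : FactorCosets f),
      ∃ (B : Type u) (_ : Group B), IsOneEnded B ∧
        Nonempty (MulAction.stabilizer K q ≃* B) := by
    intro L _ hL f hf _ q
    obtain ⟨i, g, rfl⟩ := FactorCosets.exists_eq_mk q
    exact ⟨FactorCosets.factorSubgroup f i g, inferInstance,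
      hends _ (hC _ (hL i) _ inferInstance), FactorCosets.nonempty_stabilizer_mulEquiv hf i g⟩
  obtain ⟨e, he⟩ := MulAction.exists_equiv_of_stabilizer_le
    (X := FactorCosets j) (Y := FactorCosets l)
    (fun q => by
      obtain ⟨B, _, hB, ⟨f⟩⟩ := stab hG hj q
      exact FactorCosets.exists_le_stabilizer hl hB f)
    (fun q => by
      obtain ⟨B, _, hB, ⟨f⟩⟩ := stab hH hl q
      exact FactorCosets.exists_le_stabilizer hj hB f)
    (fun q => by
      obtain ⟨B, _, hB, ⟨f⟩⟩ := stab hG hj q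
      exact FactorCosets.exists_smul_eq q hB f)
    (fun q => by
      obtain ⟨B, _, hB, ⟨f⟩⟩ := stab hH hl q
      exact FactorCosets.exists_smul_eq q hB f)
    (fun k q q' hk h h' => FactorCosets.eq_of_smul_eq hj hk h h')
    (fun k q q' hk h h' => FactorCosets.eq_of_smul_eq hl hk h h')
  have hindex : j.range.index = l.range.index := by
    have hcard := card_affineFunctions_congr e he
    rw [FactorCosets.card_affineFunctions, FactorCosets.card_affineFunctions] at hcard
    have hcard' := Nat.add_left_cancel (Nat.pow_right_injective le_rfl hcard)
    -- With a single factor the exponent would not see the index.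
    have : 1 < Nat.card ι := Finite.one_lt_card
    exact Nat.eq_of_mul_eq_mul_right (by omega) hcard'
  have hsum := MulAction.finsum_stabilizer_congr e he (fun P => absInvariant C ρ P)
    (fun P Q ⟨f⟩ => hρ.absInvariant_congr f)
  rw [hρ.finsum_absInvariant_stabilizer hC hG hj, hρ.finsum_absInvariant_stabilizer hC hH hl,
    hindex] at hsum
  exact mul_left_cancel₀ (Nat.cast_ne_zero.2 Subgroup.FiniteIndex.index_ne_zero) hsum

end Invariant

theorem theorem3p6 (C : (G : Type u) → [Group G] → Prop)
    (hC_ends : ∀ (G : Type u) [Group G], C G → IsOneEnded G)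
    (hC_closed : ClosedUnderFiniteIndex C)
    (ρ : (G : Type u) → [Group G] → ℝ)
    (hρ : IsMultiplicativeInvariant C ρ)
    (hρ_ne : ∀ (G : Type u) [Group G], C G → ρ G ≠ 0)
    (m : ℕ) (hm : 1 < m)
    (G : Fin m → Type u) [∀ i, Group (G i)] (hG : ∀ i, C (G i))
    (H : (i : Fin m) → Subgroup (G i))
    (hH_fin : ∀ i, (H i).FiniteIndex) (hH_proper : ∀ i, H i ≠ ⊤) :
    ¬ AbstractlyCommensurable (Monoid.CoprodI G) (Monoid.CoprodI fun i => H i) := by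
  rintro ⟨G', H', hG', hH', ⟨e⟩⟩
  have : Nontrivial (Fin m) := Fin.nontrivial_iff_two_le.2 hm
  have hj : G'.subtype.range.FiniteIndex := by rwa [Subgroup.range_subtype]
  have hl : (H'.subtype.comp e.toMonoidHom).range.FiniteIndex := by
    rwa [MonoidHom.range_comp, MonoidHom.range_eq_top.2 e.surjective, ← MonoidHom.range_eq_map,
      Subgroup.range_subtype]
  have hsum := (hρ.sum_abs_eq hC_closed hC_ends hG
    (fun i => hC_closed _ (hG i) _ (hH_fin i)) (j := G'.subtype)
    (l := H'.subtype.comp e.toMonoidHom) G'.subtype_injective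
    (H'.subtype_injective.comp e.injective))
  refine hsum.not_lt (Finset.sum_lt_sum_of_nonempty ⟨⟨0, by omega⟩, Finset.mem_univ _⟩
    fun i _ => ?_)
  rw [hρ.map_subgroup _ (hG i) _ (hH_fin i), abs_mul, Nat.abs_cast]
  refine lt_mul_of_one_lt_left (abs_pos.2 (hρ_ne _ (hG i))) ?_
  have h0 := (hH_fin i).index_ne_zero
  have h1 : (H i).index ≠ 1 := fun h => hH_proper i (Subgroup.index_eq_one.1 h)
  exact_mod_cast (by omega : 1 < (H i).index)
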